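/- There is an absolute constant $C>0$ (independent of $q$, $d$, $g$ and $A$) such that the following holds. Let $q$ be an odd prime power, let $\mathbb{F}_q$ be the finite field with $q$ elements, and let $g\in\mathbb{F}_q$ be a primitive element, i.e. a generator of the multiplicative group $\mathbb{F}_q^*$. Suppose that either $d=4k+1$ for some integer $k\ge 0$, or $d=4k-1$ for some integer $k\ge 1$ and $q\equiv 1 \pmod 4$. Let $$S_g=\{x\in\mathbb{F}_q^d : x_1^2+\cdots+x_d^2=g\}$$ be the sphere of radius $g$ centred at the origin. Then for every set $A\subset S_g$, the additive energy $$E(A)=\bigl|\{(a,b,c,e)\in A^4 : a+b=c+e\}\bigr|$$ satisfies $$E(A)\le C\left(\frac{|A|^3}{q}+q^{\frac{d-2}{2}}|A|^2\right).$$ -/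

import Mathlib

open Finset

/-- An element `g` of a field is primitive if it is (the value of) a generator of the
multiplicative group of nonzero elements. -/
def IsPrimitiveElement {F : Type*} [Field F] (g : F) : Prop :=
  ∃ u : Fˣ, (u : F) = g ∧ Subgroup.zpowers u = ⊤

/-- The sphere of radius `j` centred at the origin: the points `x` of `F ^ d` with
`x₁² + ⋯ + x_d² = j`. -/
def quadricSphere {F : Type*} [Field F] (d : ℕ) (j : F) : Set (Fin d → F) :=
  {x | ∑ i, x i ^ 2 = j}

/-! ### Fourier analysis of finite sets of vectors. -/

section Fourier

/-! If a + b = c + e on the sphere, substituting e = a + b - c into e ⬝ᵥ e = g gives (a - c) ⬝ᵥ (b -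
c) = 0, so the energy is at most the number of right angles in A.

When both legs are anisotropic, the character-sum bound `card_dotProduct_eq_zero_le` applies. The
anisotropic legs at c are pairwise non-proportional, so replacing them by all their nonzero
multiples first saves a factor of about q in the error term.

Angles with an isotropic leg are bounded trivially, by |A| times the number of pairs with a - c
isotropic. Lifted to (1, a) and (1, c), such pairs are orthogonal isotropic vectors of the form -g
x₀² + x₁² + ⋯ + x_d². The hypotheses on g, d and q make this form elliptic: the nonzero-frequency
Fourier coefficients of its cone are large only in the negative direction, and a one-sided estimate
keeps such pairs few (`card_isotropic_differences_le`). -/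

theorem AddChar.map_sum_eq_finset_prod {R M κ : Type*} [AddCommMonoid R] [CommMonoid M]
    (ψ : AddChar R M) (s : Finset κ) (f : κ → R) : ψ (∑ i ∈ s, f i) = ∏ i ∈ s, ψ (f i) := by
  classical
  induction s using Finset.induction_on with
  | empty => simp
  | insert i s hi ih => rw [sum_insert hi, prod_insert hi, AddChar.map_add_eq_mul, ih]

variable {F : Type*} [Field F] [Fintype F] [DecidableEq F] {ι : Type*} [Fintype ι] [DecidableEq ι]

theorem AddChar.IsPrimitive.sum_dotProduct {ψ : AddChar F ℂ} (hψ : ψ.IsPrimitive) (w : ι → F) :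
    ∑ v : ι → F, ψ (w ⬝ᵥ v) = if w = 0 then (Fintype.card F : ℂ) ^ Fintype.card ι else 0 := by
  have h : ∀ v : ι → F, ψ (w ⬝ᵥ v) = ∏ i, ψ (v i * w i) := fun v => by
    rw [dotProduct, AddChar.map_sum_eq_finset_prod]
    exact prod_congr rfl fun i _ => by rw [mul_comm]
  simp_rw [h]
  rw [← Fintype.piFinset_univ, ← prod_univ_sum (fun _ : ι => (univ : Finset F))
    (fun i t => ψ (t * w i))]
  simp_rw [AddChar.sum_mulShift _ hψ]
  split_ifs with hw
  · subst hw; simp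
  · obtain ⟨i, hi⟩ := Function.ne_iff.mp hw
    exact prod_eq_zero (mem_univ i) (by simpa using hi)

/-- The Fourier transform of the indicator function of a finite set of vectors. -/
noncomputable def indicatorFourier (ψ : AddChar F ℂ) (Y : Finset (ι → F)) (v : ι → F) : ℂ :=
  ∑ y ∈ Y, ψ (y ⬝ᵥ v)

/-- Orthogonality of characters. With W = {0} this becomes Plancherel; with W a cone it counts
orthogonal pairs of isotropic vectors. -/
theorem sum_indicatorFourier_mul_norm_sq {ψ : AddChar F ℂ} (hψ : ψ.IsPrimitive)
    (W Y : Finset (ι → F)) :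
    ∑ v, indicatorFourier ψ W v * (‖indicatorFourier ψ Y v‖ ^ 2 : ℝ) =
      (Fintype.card F : ℂ) ^ Fintype.card ι * #{p ∈ Y ×ˢ Y | p.2 - p.1 ∈ W} := by
  have h : ∀ v, indicatorFourier ψ W v * (‖indicatorFourier ψ Y v‖ ^ 2 : ℝ) =
      ∑ p ∈ Y ×ˢ Y, ∑ u ∈ W, ψ ((u - (p.2 - p.1)) ⬝ᵥ v) := fun v => by
    rw [← Complex.normSq_eq_norm_sq, ← Complex.mul_conj]
    simp only [indicatorFourier, map_sum, ← AddChar.map_neg_eq_conj]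
    rw [sum_product, sum_mul_sum, mul_sum]
    refine sum_congr rfl fun y _ => ?_
    rw [mul_sum]
    refine sum_congr rfl fun z _ => ?_
    rw [sum_mul]
    refine sum_congr rfl fun u _ => ?_
    rw [← AddChar.map_add_eq_mul, ← AddChar.map_add_eq_mul]
    congr 1
    simp only [sub_dotProduct]
    ring
  simp_rw [h]
  rw [sum_comm]
  have h2 : ∀ p ∈ Y ×ˢ Y, ∑ v : ι → F, ∑ u ∈ W, ψ ((u - (p.2 - p.1)) ⬝ᵥ v) =
      if p.2 - p.1 ∈ W then (Fintype.card F : ℂ) ^ Fintype.card ι else 0 := fun p _ => by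
    rw [sum_comm]
    simp_rw [hψ.sum_dotProduct, sub_eq_zero]
    simp
  rw [sum_congr rfl h2, ← sum_filter, sum_const, nsmul_eq_mul, mul_comm]

theorem sum_norm_sq_indicatorFourier {ψ : AddChar F ℂ} (hψ : ψ.IsPrimitive)
    (Y : Finset (ι → F)) :
    ∑ v, ‖indicatorFourier ψ Y v‖ ^ 2 = (Fintype.card F : ℝ) ^ Fintype.card ι * #Y := by
  have h := sum_indicatorFourier_mul_norm_sq hψ {0} Y
  have h1 : #{p ∈ Y ×ˢ Y | p.2 - p.1 ∈ ({0} : Finset (ι → F))} = #Y := by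
    rw [← diag_card Y]
    congr 1
    ext ⟨a, b⟩
    simp only [mem_filter, mem_product, mem_singleton, sub_eq_zero, mem_diag]
    constructor
    · rintro ⟨⟨ha, -⟩, rfl⟩; exact ⟨ha, rfl⟩
    · rintro ⟨ha, rfl⟩; exact ⟨⟨ha, ha⟩, rfl⟩
  rw [h1] at h
  have h2 : ∀ v, indicatorFourier ψ ({0} : Finset (ι → F)) v = 1 := fun v => by
    simp [indicatorFourier]
  simp_rw [h2, one_mul] at h
  exact_mod_cast h

/-- Orthogonality is detected by averaging ψ(t (y ⬝ᵥ z)) over t: t = 0 gives the main term, and each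
other t is controlled by Cauchy–Schwarz and Plancherel. -/
theorem card_dotProduct_eq_zero_le (Y : Finset (ι → F)) :
    (#{p ∈ Y ×ˢ Y | p.1 ⬝ᵥ p.2 = 0} : ℝ) ≤ (#Y : ℝ) ^ 2 / Fintype.card F +
      √((Fintype.card F : ℝ) ^ Fintype.card ι) * #Y := by
  obtain ⟨ψ, hψ⟩ : ∃ ψ : AddChar F ℂ, ψ.IsPrimitive :=
    ⟨_, AddChar.FiniteField.primitiveChar_to_Complex_isPrimitive (F := F)⟩
  set q : ℝ := (Fintype.card F : ℝ) with hq
  have hq0 : 0 < q := by rw [hq]; exact_mod_cast Fintype.card_pos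
  set K := √(q ^ Fintype.card ι) with hK
  have hinner : ∀ t : F, t ≠ 0 →
      ‖∑ y ∈ Y, indicatorFourier ψ Y (t • y)‖ ≤ K * #Y := fun t ht => by
    have h1 : (∑ y ∈ Y, ‖indicatorFourier ψ Y (t • y)‖) ^ 2 ≤ (K * #Y) ^ 2 := calc
      _ ≤ #Y * ∑ y ∈ Y, ‖indicatorFourier ψ Y (t • y)‖ ^ 2 := sq_sum_le_card_mul_sum_sq
      _ ≤ #Y * ∑ y, ‖indicatorFourier ψ Y (t • y)‖ ^ 2 := by
        gcongr
        exact subset_univ _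
      _ = #Y * ∑ y, ‖indicatorFourier ψ Y y‖ ^ 2 := by
        congr 1
        exact Equiv.sum_comp (MulAction.toPerm (Units.mk0 t ht))
          (fun y => ‖indicatorFourier ψ Y y‖ ^ 2)
      _ = (K * #Y) ^ 2 := by
        rw [sum_norm_sq_indicatorFourier hψ, mul_pow, hK, Real.sq_sqrt (by positivity)]
        ring
    exact (norm_sum_le _ _).trans ((le_abs_self _).trans (abs_le_of_sq_le_sq h1 (by positivity)))
  have hcount : (q : ℂ) * #{p ∈ Y ×ˢ Y | p.1 ⬝ᵥ p.2 = 0} =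
      ∑ t : F, ∑ y ∈ Y, indicatorFourier ψ Y (t • y) := by
    simp only [indicatorFourier, dotProduct_smul, smul_eq_mul]
    rw [sum_comm, mul_comm, card_filter, sum_product, Nat.cast_sum, sum_mul]
    refine sum_congr rfl fun y _ => ?_
    rw [sum_comm, Nat.cast_sum, sum_mul]
    refine sum_congr rfl fun z _ => ?_
    rw [AddChar.sum_mulShift _ hψ, dotProduct_comm z y]
    split_ifs <;> simp [hq]
  have hmain : q * #{p ∈ Y ×ˢ Y | p.1 ⬝ᵥ p.2 = 0} ≤ (#Y : ℝ) ^ 2 + q * (K * #Y) := by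
    have h0 : ∑ y ∈ Y, indicatorFourier ψ Y ((0 : F) • y) = (#Y : ℂ) ^ 2 := by
      simp [indicatorFourier, sq]
    have h1 : q * #{p ∈ Y ×ˢ Y | p.1 ⬝ᵥ p.2 = 0} =
        ‖∑ t : F, ∑ y ∈ Y, indicatorFourier ψ Y (t • y)‖ := by
      rw [← hcount, norm_mul, Complex.norm_natCast, Complex.norm_real, Real.norm_of_nonneg hq0.le]
    rw [h1, ← add_sum_erase univ _ (mem_univ (0 : F)), h0]
    refine (norm_add_le _ _).trans (add_le_add (by simp) ?_)
    refine (norm_sum_le_of_le _ fun t ht => hinner t (ne_of_mem_erase ht)).trans ?_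
    rw [sum_const, nsmul_eq_mul]
    refine mul_le_mul_of_nonneg_right ?_ (by positivity)
    rw [hq]
    exact_mod_cast card_le_univ _
  rw [← sub_nonneg] at hmain ⊢
  have : (#Y : ℝ) ^ 2 / q + K * #Y - #{p ∈ Y ×ˢ Y | p.1 ⬝ᵥ p.2 = 0} =
    ((#Y : ℝ) ^ 2 + q * (K * #Y) - q * #{p ∈ Y ×ˢ Y | p.1 ⬝ᵥ p.2 = 0}) / q := by
    field_simp
  rw [this]
  positivity

end Fourier

/-! ### Gauss sums and cones of elliptic quadratic forms. -/

section Cone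

variable {F : Type*} [Field F] [Fintype F] [DecidableEq F]

theorem sum_addChar_quadratic (hF : ringChar F ≠ 2) {ψ : AddChar F ℂ} (hψ : ψ.IsPrimitive)
    {a : F} (ha : a ≠ 0) (b : F) :
    ∑ x, ψ (a * x ^ 2 + x * b) = quadraticChar F a *
      gaussSum ((quadraticChar F).ringHomComp (Int.castRingHom ℂ)) ψ * ψ (-(b ^ 2 / (4 * a))) := by
  have h2 : (2 : F) ≠ 0 := Ring.two_ne_zero hF
  have h4 : (4 : F) ≠ 0 := by
    have : (4 : F) = 2 * 2 := by norm_num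
    rw [this]; exact mul_ne_zero h2 h2
  have hshift : ∑ x, ψ (a * x ^ 2 + x * b) = (∑ x, ψ (a * x ^ 2)) * ψ (-(b ^ 2 / (4 * a))) := by
    rw [sum_mul, ← Equiv.sum_comp (Equiv.addRight (b / (2 * a)))
      fun x => ψ (a * x ^ 2) * ψ (-(b ^ 2 / (4 * a)))]
    refine sum_congr rfl fun x _ => ?_
    rw [← AddChar.map_add_eq_mul, Equiv.coe_addRight]
    congr 1
    field_simp
    ring
  have hsq : ∑ x, ψ (a * x ^ 2) = ∑ y, ((quadraticChar F y : ℂ) + 1) * ψ (a * y) := by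
    rw [← sum_fiberwise_of_maps_to (g := fun x : F => x ^ 2) (t := univ) (fun _ _ => mem_univ _)]
    refine sum_congr rfl fun y _ => ?_
    have hc := quadraticChar_card_sqrts hF y
    have hc' : ((#{x : F | x ^ 2 = y} : ℕ) : ℂ) = quadraticChar F y + 1 := by
      rw [← Int.cast_one, ← Int.cast_add, ← hc]
      simp
    rw [← hc', ← nsmul_eq_mul, ← sum_const]
    refine sum_congr rfl fun x hx => ?_
    rw [(mem_filter.mp hx).2]
  have hG := gaussSum_mulShift ((quadraticChar F).ringHomComp (Int.castRingHom ℂ)) ψ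
    (Units.mk0 a ha)
  have hlin : ∑ y, ψ (a * y) = 0 := by
    have := AddChar.sum_mulShift a hψ
    simp_rw [mul_comm a, this, if_neg ha, Nat.cast_zero]
  have hsqa : ((quadraticChar F a : ℤ) : ℂ) * quadraticChar F a = 1 := by
    rw [← sq]
    exact_mod_cast quadraticChar_sq_one ha
  rw [hshift, hsq]
  congr 1
  simp_rw [add_mul, one_mul]
  rw [sum_add_distrib, hlin, add_zero, ← hG]
  simp only [gaussSum, MulChar.ringHomComp_apply, AddChar.mulShift_apply, Units.val_mk0, eq_intCast]
  rw [← mul_assoc, hsqa, one_mul]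

variable {ι : Type*} [Fintype ι] [DecidableEq ι]

/-- The sum splits into an even number of one-variable Gauss sums. The factors χ(s) cancel in pairs
and each squared Gauss sum is χ(-1)q, so the sign does not depend on s; the elliptic condition
`hell` makes it -1. -/
theorem sum_addChar_diagonal (hF : ringChar F ≠ 2) {ψ : AddChar F ℂ} (hψ : ψ.IsPrimitive)
    {α : ι → F} (hα : ∀ i, α i ≠ 0) {m : ℕ} (hm : Fintype.card ι = 2 * (m + 1))
    (hell : quadraticChar F (-1) ^ (m + 1) * ∏ i, quadraticChar F (α i) = -1)
    (v : ι → F) {s : F} (hs : s ≠ 0) :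
    ∑ u : ι → F, ψ (s * ∑ i, α i * u i ^ 2) * ψ (u ⬝ᵥ v) =
      -(Fintype.card F : ℂ) ^ (m + 1) * ψ (s⁻¹ * -∑ i, v i ^ 2 / (4 * α i)) := by
  have h : ∀ u : ι → F, ψ (s * ∑ i, α i * u i ^ 2) * ψ (u ⬝ᵥ v) =
      ∏ i, ψ ((s * α i) * u i ^ 2 + u i * v i) := fun u => by
    rw [← AddChar.map_add_eq_mul, ← AddChar.map_sum_eq_finset_prod, sum_add_distrib, mul_sum]
    simp only [mul_assoc]
    rfl
  simp_rw [h]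
  rw [← Fintype.piFinset_univ, ← prod_univ_sum (fun _ : ι => (univ : Finset F))
    (fun i t => ψ ((s * α i) * t ^ 2 + t * v i))]
  simp_rw [sum_addChar_quadratic hF hψ (mul_ne_zero hs (hα _))]
  rw [prod_mul_distrib, prod_mul_distrib, ← AddChar.map_sum_eq_finset_prod, prod_const, card_univ,
    hm, pow_mul, gaussSum_sq, MulChar.ringHomComp_apply]
  · have h1 : (∏ i, ((quadraticChar F (s * α i) : ℤ) : ℂ)) * ((Int.castRingHom ℂ)
        (quadraticChar F (-1)) * (Fintype.card F : ℂ)) ^ (m + 1) =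
        -(Fintype.card F : ℂ) ^ (m + 1) := by
      have h2 : (∏ i, quadraticChar F (s * α i)) * quadraticChar F (-1) ^ (m + 1) = -1 := by
        simp_rw [map_mul]
        rw [prod_mul_distrib, prod_const, card_univ, hm, pow_mul, quadraticChar_sq_one hs, one_pow,
          one_mul, mul_comm, hell]
      rw [mul_pow, ← mul_assoc]
      have h3 := congrArg (Int.cast : ℤ → ℂ) h2
      push_cast at h3
      simp only [eq_intCast]
      rw [h3]
      ring
    rw [h1]
    congr 2
    rw [mul_neg, sum_neg_distrib, mul_sum]
    congr 1
    refine sum_congr rfl fun i _ => ?_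
    field_simp
  · exact (MulChar.ringHomComp_ne_one_iff (RingHom.injective_int _)).mpr (quadraticChar_ne_one hF)
  · exact (quadraticChar_isQuadratic F).comp _
  · exact hψ

/-- One-sided bound for the Fourier transform of the cone of a diagonal form of elliptic type. -/
theorem exists_indicatorFourier_cone_eq (hF : ringChar F ≠ 2) {ψ : AddChar F ℂ}
    (hψ : ψ.IsPrimitive) {α : ι → F} (hα : ∀ i, α i ≠ 0) {m : ℕ}
    (hm : Fintype.card ι = 2 * (m + 1))
    (hell : quadraticChar F (-1) ^ (m + 1) * ∏ i, quadraticChar F (α i) = -1) (v : ι → F) :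
    ∃ r : ℝ, indicatorFourier ψ {u | ∑ i, α i * u i ^ 2 = 0} v = r ∧
      Fintype.card F * r ≤ (if v = 0 then (Fintype.card F : ℝ) ^ Fintype.card ι else 0) +
        (Fintype.card F : ℝ) ^ (m + 1) := by
  set P := -∑ i, v i ^ 2 / (4 * α i) with hP
  set q : ℝ := (Fintype.card F : ℝ) with hq
  have hq0 : 0 < q := by rw [hq]; exact_mod_cast Fintype.card_pos
  have hinv : ∑ s ∈ univ.erase (0 : F), ψ (s⁻¹ * P) = (if P = 0 then (q : ℂ) else 0) - 1 := by
    rw [← sum_bijective (s := univ.erase (0 : F)) (f := fun s => ψ (s * P)) (fun s : F => s⁻¹)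
      inv_involutive.bijective (by simp) (by simp)]
    have h := AddChar.sum_mulShift P hψ
    rw [← add_sum_erase univ _ (mem_univ (0 : F)), zero_mul, AddChar.map_zero_eq_one] at h
    rw [eq_sub_iff_add_eq', h, hq]
    split_ifs <;> simp
  have hcount : (q : ℂ) * indicatorFourier ψ {u | ∑ i, α i * u i ^ 2 = 0} v =
      (if v = 0 then (q : ℂ) ^ Fintype.card ι else 0) -
        (q : ℂ) ^ (m + 1) * ((if P = 0 then (q : ℂ) else 0) - 1) := by
    have h1 : (q : ℂ) * indicatorFourier ψ {u | ∑ i, α i * u i ^ 2 = 0} v =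
        ∑ s : F, ∑ u : ι → F, ψ (s * ∑ i, α i * u i ^ 2) * ψ (u ⬝ᵥ v) := by
      rw [sum_comm]
      simp_rw [← sum_mul, AddChar.sum_mulShift _ hψ]
      rw [indicatorFourier, sum_filter, mul_sum]
      refine sum_congr rfl fun u _ => ?_
      split_ifs <;> simp [hq]
    rw [h1, ← add_sum_erase univ _ (mem_univ (0 : F)), sum_congr rfl fun s hs =>
      sum_addChar_diagonal hF hψ hα hm hell v (ne_of_mem_erase hs), ← mul_sum, hinv]
    simp only [zero_mul, AddChar.map_zero_eq_one, one_mul]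
    simp_rw [dotProduct_comm _ v]
    rw [hψ.sum_dotProduct, hq]
    push_cast
    ring
  refine ⟨((if v = 0 then q ^ Fintype.card ι else 0) -
        q ^ (m + 1) * ((if P = 0 then q else 0) - 1)) / q, ?_, ?_⟩
  · have hq' : (q : ℂ) ≠ 0 := by exact_mod_cast hq0.ne'
    push_cast
    rw [eq_div_iff hq', mul_comm, hcount]
    split_ifs <;> simp
  · rw [mul_div_cancel₀ _ hq0.ne']
    -- The elliptic sign makes the large contribution from P = 0 negative, so an upper bound may
    -- drop it.
    have : 0 ≤ q ^ (m + 1) * (if P = 0 then q else 0) := by positivity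
    linarith

/-- Two isotropic vectors are orthogonal exactly when their difference lies on the cone. The weights
‖·‖² are nonnegative, so the one-sided bound suffices and gives error q ^ m, against q ^ (m + 1) in
the general estimate. -/
theorem card_isotropic_orthogonal_le (hF : ringChar F ≠ 2) {α : ι → F} (hα : ∀ i, α i ≠ 0) {m : ℕ}
    (hm : Fintype.card ι = 2 * (m + 1))
    (hell : quadraticChar F (-1) ^ (m + 1) * ∏ i, quadraticChar F (α i) = -1)
    (Y : Finset (ι → F)) (hY : ∀ y ∈ Y, ∑ i, α i * y i ^ 2 = 0) :
    (#{p ∈ Y ×ˢ Y | ∑ i, α i * (p.1 i * p.2 i) = 0} : ℝ) ≤ (#Y : ℝ) ^ 2 / Fintype.card F +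
      (Fintype.card F : ℝ) ^ m * #Y := by
  obtain ⟨ψ, hψ⟩ : ∃ ψ : AddChar F ℂ, ψ.IsPrimitive :=
    ⟨_, AddChar.FiniteField.primitiveChar_to_Complex_isPrimitive (F := F)⟩
  set q : ℝ := (Fintype.card F : ℝ) with hq
  have hq0 : 0 < q := by rw [hq]; exact_mod_cast Fintype.card_pos
  choose r hr hrle using exists_indicatorFourier_cone_eq hF hψ hα hm hell
  have h := sum_indicatorFourier_mul_norm_sq hψ ({u | ∑ i, α i * u i ^ 2 = 0} : Finset (ι → F)) Y
  have hset : #{p ∈ Y ×ˢ Y | p.2 - p.1 ∈ ({u | ∑ i, α i * u i ^ 2 = 0} : Finset (ι → F))} =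
      #{p ∈ Y ×ˢ Y | ∑ i, α i * (p.1 i * p.2 i) = 0} := by
    congr 1
    refine filter_congr fun p hp => ?_
    rw [mem_product] at hp
    have h1 : ∑ i, α i * (p.2 - p.1) i ^ 2 = ∑ i, α i * p.2 i ^ 2 + ∑ i, α i * p.1 i ^ 2 -
        2 * ∑ i, α i * (p.1 i * p.2 i) := by
      rw [mul_sum, ← sum_add_distrib, ← sum_sub_distrib]
      refine sum_congr rfl fun i _ => ?_
      simp only [Pi.sub_apply]
      ring
    rw [mem_filter_univ, h1, hY _ hp.1, hY _ hp.2]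
    simp [Ring.two_ne_zero hF]
  rw [hset] at h
  simp_rw [hr] at h
  have h' : ∑ v, r v * ‖indicatorFourier ψ Y v‖ ^ 2 =
      q ^ Fintype.card ι * #{p ∈ Y ×ˢ Y | ∑ i, α i * (p.1 i * p.2 i) = 0} := by
    rw [hq]
    exact_mod_cast h
  have h0 : ‖indicatorFourier ψ Y 0‖ = #Y := by simp [indicatorFourier]
  have hle : q * (q ^ Fintype.card ι * #{p ∈ Y ×ˢ Y | ∑ i, α i * (p.1 i * p.2 i) = 0}) ≤
      q ^ Fintype.card ι * #Y ^ 2 + q ^ (m + 1) * (q ^ Fintype.card ι * #Y) := by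
    rw [← h', ← sum_norm_sq_indicatorFourier hψ, mul_sum, mul_sum, ← h0]
    calc _ ≤ ∑ v, ((if v = 0 then q ^ Fintype.card ι * ‖indicatorFourier ψ Y v‖ ^ 2 else 0) +
          q ^ (m + 1) * ‖indicatorFourier ψ Y v‖ ^ 2) := by
          refine sum_le_sum fun v _ => ?_
          have := mul_le_mul_of_nonneg_right (hrle v) (sq_nonneg ‖indicatorFourier ψ Y v‖)
          rw [← mul_assoc]
          refine this.trans (le_of_eq ?_)
          split_ifs <;> ring
      _ = _ := by
          rw [sum_add_distrib]
          simp
  have hpos : 0 < q * q ^ Fintype.card ι := by positivity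
  refine le_of_mul_le_mul_left (?_ : q * q ^ Fintype.card ι * _ ≤ q * q ^ Fintype.card ι * _) hpos
  rw [mul_assoc]
  refine hle.trans (le_of_eq ?_)
  field_simp
  ring

end Cone

/-! ### Passing to all scalar multiples. -/

section Scaling

variable {F : Type*} [Field F] [Fintype F] [DecidableEq F] {ι : Type*} [Fintype ι]

/-- Replacing pairwise non-proportional vectors by all their nonzero multiples multiplies the
number of orthogonal pairs by the square of the number of scalars. -/
theorem exists_scaled_finset (α : ι → F) (X : Finset (ι → F)) (h0 : ∀ x ∈ X, x ≠ 0)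
    (hX : ∀ x ∈ X, ∀ y ∈ X, ∀ t : F, t • x = y → x = y) :
    ∃ Y : Finset (ι → F), #Y = Fintype.card Fˣ * #X ∧
      (∀ y ∈ Y, ∃ t : F, ∃ x ∈ X, y = t • x) ∧
      #{p ∈ Y ×ˢ Y | ∑ i, α i * (p.1 i * p.2 i) = 0} =
        Fintype.card Fˣ ^ 2 * #{p ∈ X ×ˢ X | ∑ i, α i * (p.1 i * p.2 i) = 0} := by
  have hinj : Set.InjOn (fun p : Fˣ × (ι → F) => p.1 • p.2)
      ((univ ×ˢ X : Finset (Fˣ × (ι → F))) : Set (Fˣ × (ι → F))) := by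
    rintro ⟨t, x⟩ hx ⟨s, y⟩ hy hxy
    simp only [coe_product, Set.mem_prod, mem_coe] at hx hy
    simp only at hxy
    have hxy' : x = y := hX x hx.2 y hy.2 ((s⁻¹ * t : Fˣ) : F) (by
      have : (s⁻¹ * t) • x = y := by rw [mul_smul, hxy, inv_smul_smul]
      exact this)
    subst hxy'
    have : (t : F) = s := smul_left_injective F (h0 x hx.2) hxy
    rw [Units.ext this]
  refine ⟨(univ ×ˢ X).image fun p : Fˣ × (ι → F) => p.1 • p.2, ?_, ?_, ?_⟩
  · rw [card_image_of_injOn hinj, card_product, card_univ]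
  · intro y hy
    obtain ⟨⟨t, x⟩, hp, rfl⟩ := mem_image.mp hy
    exact ⟨t, x, (mem_product.mp hp).2, rfl⟩
  · have hR : ∀ (t s : Fˣ) (x y : ι → F),
        ∑ i, α i * ((t • x) i * (s • y) i) = 0 ↔ ∑ i, α i * (x i * y i) = 0 := by
      intro t s x y
      have : ∑ i, α i * ((t • x) i * (s • y) i) = (t * s : F) * ∑ i, α i * (x i * y i) := by
        rw [mul_sum]
        refine sum_congr rfl fun i _ => ?_
        simp only [Pi.smul_apply, Units.smul_def, smul_eq_mul]
        ring
      rw [this]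
      simp
    rw [card_filter, card_filter, sum_product, sum_product, sum_image hinj, sum_product]
    simp_rw [sum_image hinj, sum_product, hR, sum_const, smul_eq_mul, card_univ, ← mul_sum]
    ring

theorem le_of_scaled_le {n a K : ℝ} {c : ℕ} (hc : 2 ≤ c) (ha : 0 ≤ a) (hK : 0 ≤ K)
    (h : (c - 1 : ℝ) ^ 2 * n ≤ ((c - 1 : ℝ) * a) ^ 2 / c + K * ((c - 1 : ℝ) * a)) :
    n ≤ a ^ 2 / c + 2 * (K / c) * a := by
  have hc' : (2 : ℝ) ≤ c := by exact_mod_cast hc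
  have h1 : (0 : ℝ) < c - 1 := by linarith
  have h2 : n ≤ a ^ 2 / c + K / (c - 1) * a := by
    refine le_of_mul_le_mul_left (h.trans (le_of_eq ?_)) (pow_pos h1 2)
    field_simp
  refine h2.trans ?_
  gcongr
  rw [div_le_iff₀ h1, mul_comm 2, div_mul_eq_mul_div, div_mul_eq_mul_div, le_div_iff₀ (by linarith)]
  nlinarith

/-- Scaling multiplies the pair count by (q - 1)² but the linear error term only by q - 1, so K
improves to K / (q - 1) ≤ 2K / q. -/
theorem card_orthogonal_le_of_scaled {α : ι → F} {X : Finset (ι → F)} (h0 : ∀ x ∈ X, x ≠ 0)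
    (hX : ∀ x ∈ X, ∀ y ∈ X, ∀ t : F, t • x = y → x = y) {K : ℝ} (hK : 0 ≤ K)
    (hY : ∀ Y : Finset (ι → F), (∀ y ∈ Y, ∃ t : F, ∃ x ∈ X, y = t • x) →
      (#{p ∈ Y ×ˢ Y | ∑ i, α i * (p.1 i * p.2 i) = 0} : ℝ) ≤
        (#Y : ℝ) ^ 2 / Fintype.card F + K * #Y) :
    (#{p ∈ X ×ˢ X | ∑ i, α i * (p.1 i * p.2 i) = 0} : ℝ) ≤
      (#X : ℝ) ^ 2 / Fintype.card F + 2 * (K / Fintype.card F) * #X := by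
  obtain ⟨Y, hcard, hmem, horth⟩ := exists_scaled_finset α X h0 hX
  have h := hY Y hmem
  have hu : (Fintype.card Fˣ : ℝ) = Fintype.card F - 1 := by
    rw [Fintype.card_units, Nat.cast_sub Fintype.card_pos, Nat.cast_one]
  rw [horth, hcard] at h
  push_cast [hu] at h
  exact le_of_scaled_le Fintype.one_lt_card (Nat.cast_nonneg _) hK h

end Scaling

/-! ### Right angles and isotropic differences on a sphere. -/

section Sphere

variable {F : Type*} [Field F] [DecidableEq F] {d : ℕ}

theorem addEnergy_le_sum_right_angles {g : F} (hF : ringChar F ≠ 2) (A : Finset (Fin d → F))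
    (hA : ∀ a ∈ A, a ⬝ᵥ a = g) :
    addEnergy A A ≤ ∑ c ∈ A, #{p ∈ A ×ˢ A | (p.1 - c) ⬝ᵥ (p.2 - c) = 0} := by
  rw [addEnergy, ← card_sigma]
  refine card_le_card_of_injOn (fun x => ⟨x.1.2, (x.1.1, x.2.1)⟩) ?_ ?_
  · rintro ⟨⟨a, c⟩, ⟨b, e⟩⟩ h
    simp only [coe_filter, mem_product, Set.mem_ofPred_eq] at h
    obtain ⟨⟨⟨ha, hc⟩, hb, he⟩, h⟩ := h
    simp only [coe_sigma, Set.mem_sigma_iff, mem_coe, mem_filter, mem_product]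
    refine ⟨hc, ⟨ha, hb⟩, ?_⟩
    have he' := hA e he
    rw [eq_sub_of_add_eq' h.symm] at he'
    simp only [sub_dotProduct, dotProduct_sub, add_dotProduct, dotProduct_add, hA a ha, hA b hb,
      hA c hc, dotProduct_comm c a, dotProduct_comm c b, dotProduct_comm b a] at he' ⊢
    have h2 : (2 : F) * (a ⬝ᵥ b - c ⬝ᵥ b - (a ⬝ᵥ c - g)) = 0 := by
      rw [dotProduct_comm c b]
      linear_combination he'
    have h3 := (mul_eq_zero.mp h2).resolve_left (Ring.two_ne_zero hF)
    rw [dotProduct_comm c b] at h3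
    linear_combination h3
  · rintro ⟨⟨a, c⟩, ⟨b, e⟩⟩ h ⟨⟨a', c'⟩, ⟨b', e'⟩⟩ h' heq
    simp only [coe_filter, mem_product, Set.mem_ofPred_eq] at h h'
    simp only [Sigma.mk.injEq, heq_eq_eq, Prod.mk.injEq] at heq
    obtain ⟨rfl, rfl, rfl⟩ := heq
    have : e = e' := add_left_cancel (h.2.symm.trans h'.2)
    rw [this]

variable [Fintype F]

theorem card_isotropic_differences_le (hF : ringChar F ≠ 2) {g : F} (hg : g ≠ 0) {m : ℕ}
    (hd : d = 2 * m + 1) (hell : quadraticChar F (-1) ^ (m + 1) * quadraticChar F (-g) = -1)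
    (A : Finset (Fin d → F)) (hA : ∀ a ∈ A, a ⬝ᵥ a = g) :
    (#{p ∈ A ×ˢ A | (p.1 - p.2) ⬝ᵥ (p.1 - p.2) = 0} : ℝ) ≤
      (#A : ℝ) ^ 2 / Fintype.card F + 2 * ((Fintype.card F : ℝ) ^ m / Fintype.card F) * #A := by
  set α : Fin (d + 1) → F := Fin.cons (-g) fun _ => 1 with hαdef
  -- The lift is isotropic because a ⬝ᵥ a = g, and its first coordinate 1 prevents distinct lifts
  -- from being proportional.
  let lift : (Fin d → F) → Fin (d + 1) → F := fun a => Fin.cons 1 a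
  have hlift : Function.Injective lift := fun a b h => (Fin.cons_injective2 h).2
  have hB : ∀ a b, ∑ i, α i * (lift a i * lift b i) = a ⬝ᵥ b - g := fun a b => by
    simp [Fin.sum_univ_succ, hαdef, lift, dotProduct]
    ring
  have hα : ∀ i, α i ≠ 0 := by
    intro i
    refine Fin.cases ?_ (fun j => ?_) i <;> simp [hαdef, hg]
  have key := card_orthogonal_le_of_scaled (α := α) (X := A.image lift)
    (K := (Fintype.card F : ℝ) ^ m) ?_ ?_ (by positivity) ?_
  · rw [card_image_of_injective _ hlift] at key
    refine le_trans (le_of_eq ?_) key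
    norm_cast
    refine card_bij (fun p _ => (lift p.1, lift p.2)) ?_ ?_ ?_
    · rintro ⟨a, b⟩ hp
      simp only [mem_filter, mem_product] at hp ⊢
      refine ⟨⟨mem_image_of_mem _ hp.1.1, mem_image_of_mem _ hp.1.2⟩, ?_⟩
      rw [hB]
      have h := hp.2
      rw [sub_dotProduct, dotProduct_sub, dotProduct_sub, hA a hp.1.1, hA b hp.1.2,
        dotProduct_comm b a] at h
      have h2 : (2 : F) * (a ⬝ᵥ b - g) = 0 := by linear_combination -h
      exact (mul_eq_zero.mp h2).resolve_left (Ring.two_ne_zero hF)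
    · rintro ⟨a, b⟩ _ ⟨a', b'⟩ _ h
      rw [Prod.mk.injEq] at h
      exact Prod.ext (hlift h.1) (hlift h.2)
    · rintro ⟨x, y⟩ hp
      simp only [mem_filter, mem_product, mem_image] at hp
      obtain ⟨⟨⟨a, ha, rfl⟩, ⟨b, hb, rfl⟩⟩, h⟩ := hp
      refine ⟨(a, b), ?_, rfl⟩
      simp only [mem_filter, mem_product]
      refine ⟨⟨ha, hb⟩, ?_⟩
      rw [hB] at h
      rw [sub_dotProduct, dotProduct_sub, dotProduct_sub, hA a ha, hA b hb, dotProduct_comm b a]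
      linear_combination -2 * h
  · intro x hx
    obtain ⟨a, -, rfl⟩ := mem_image.mp hx
    intro h
    simpa [lift] using congrFun h 0
  · intro x hx y hy t h
    obtain ⟨a, -, rfl⟩ := mem_image.mp hx
    obtain ⟨b, -, rfl⟩ := mem_image.mp hy
    have ht : t = 1 := by simpa [lift] using congrFun h 0
    rw [← h, ht, one_smul]
  · intro Y hY
    refine card_isotropic_orthogonal_le hF hα (by rw [Fintype.card_fin, hd]; ring) ?_ Y ?_
    · rw [Fin.prod_univ_succ]
      simpa [hαdef] using hell
    · intro y hy
      obtain ⟨t, x, hx, rfl⟩ := hY y hy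
      obtain ⟨a, ha, rfl⟩ := mem_image.mp hx
      have h := hB a a
      rw [hA a ha, sub_self] at h
      calc _ = t ^ 2 * ∑ i, α i * (lift a i * lift a i) := by
            rw [mul_sum]
            refine sum_congr rfl fun i _ => ?_
            simp only [Pi.smul_apply, smul_eq_mul]
            ring
        _ = 0 := by rw [h, mul_zero]

theorem card_right_angles_anisotropic_le {g : F} (A : Finset (Fin d → F))
    (hA : ∀ a ∈ A, a ⬝ᵥ a = g) {c : Fin d → F} (hc : c ⬝ᵥ c = g) :
    (#{p ∈ A ×ˢ A | (p.1 - c) ⬝ᵥ (p.2 - c) = 0 ∧ (p.1 - c) ⬝ᵥ (p.1 - c) ≠ 0 ∧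
        (p.2 - c) ⬝ᵥ (p.2 - c) ≠ 0} : ℝ) ≤
      (#A : ℝ) ^ 2 / Fintype.card F +
        2 * (√((Fintype.card F : ℝ) ^ d) / Fintype.card F) * #A := by
  set X : Finset (Fin d → F) := {x ∈ A.image (· - c) | x ⬝ᵥ x ≠ 0} with hX
  have hXA : (#X : ℝ) ≤ #A := by
    exact_mod_cast (card_filter_le _ _).trans card_image_le
  -- The sphere equation at c + x fixes the scale of x: an anisotropic line through c meets the
  -- sphere in at most one further point.
  have hXc : ∀ x ∈ X, x ⬝ᵥ x = -2 * (c ⬝ᵥ x) := by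
    intro x hx
    obtain ⟨a, ha, rfl⟩ := mem_image.mp (mem_filter.mp hx).1
    rw [sub_dotProduct, dotProduct_sub, dotProduct_sub, hA a ha, hc, dotProduct_comm a c]
    ring
  have key := card_orthogonal_le_of_scaled (α := fun _ => (1 : F)) (X := X)
    (K := √((Fintype.card F : ℝ) ^ d)) ?_ ?_ (by positivity) ?_
  · refine le_trans ?_ (key.trans ?_)
    · norm_cast
      refine card_le_card_of_injOn (fun p => (p.1 - c, p.2 - c)) ?_ ?_
      · rintro ⟨a, b⟩ hp
        simp only [coe_filter, mem_product, Set.mem_ofPred_eq] at hp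
        simp only [coe_filter, mem_product, Set.mem_ofPred_eq, hX, mem_filter, one_mul]
        exact ⟨⟨⟨mem_image_of_mem _ hp.1.1, hp.2.2.1⟩, mem_image_of_mem _ hp.1.2, hp.2.2.2⟩, hp.2.1⟩
      · rintro ⟨a, b⟩ _ ⟨a', b'⟩ _ h
        simpa using h
    · gcongr
  · rintro x hx rfl
    exact (mem_filter.mp hx).2 (by simp)
  · rintro x hx y hy t rfl
    have hxne := (mem_filter.mp hx).2
    have hyne := (mem_filter.mp hy).2
    have h := hXc _ hy
    rw [smul_dotProduct, dotProduct_smul, dotProduct_smul, smul_eq_mul, smul_eq_mul,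
      smul_eq_mul] at h
    have ht : t ≠ 0 := by rintro rfl; simp at hyne
    have h2 : t * (x ⬝ᵥ x) * (t - 1) = 0 := by linear_combination h - t * hXc x hx
    have h3 := (mul_eq_zero.mp h2).resolve_left (mul_ne_zero ht hxne)
    rw [sub_eq_zero.mp h3, one_smul]
  · intro Y _
    have h := card_dotProduct_eq_zero_le Y
    rw [Fintype.card_fin] at h
    convert h using 6
    simp [dotProduct]

theorem addEnergy_le_of_elliptic (hF : ringChar F ≠ 2) {g : F} (hg : g ≠ 0) {m : ℕ}
    (hd : d = 2 * m + 1) (hell : quadraticChar F (-1) ^ (m + 1) * quadraticChar F (-g) = -1)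
    (A : Finset (Fin d → F)) (hA : ∀ a ∈ A, a ⬝ᵥ a = g) :
    (addEnergy A A : ℝ) ≤ 6 * ((#A : ℝ) ^ 3 / Fintype.card F +
      (Fintype.card F : ℝ) ^ (((d : ℝ) - 2) / 2) * (#A : ℝ) ^ 2) := by
  set q : ℝ := (Fintype.card F : ℝ) with hq
  have hq1 : 1 ≤ q := by rw [hq]; exact_mod_cast Fintype.card_pos
  set L : ℝ := q ^ (((d : ℝ) - 2) / 2) with hL
  have hsqrt : √(q ^ d) / q = L := by
    have : ((d : ℝ) - 2) / 2 = d * (1 / 2) - 1 := by ring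
    rw [hL, this, Real.rpow_sub_one (by positivity), Real.rpow_mul (by positivity),
      Real.rpow_natCast, Real.sqrt_eq_rpow]
  have hpow : q ^ m / q ≤ L := by
    rw [← hsqrt]
    gcongr
    refine Real.le_sqrt_of_sq_le ?_
    rw [← pow_mul]
    exact pow_le_pow_right₀ hq1 (by omega)
  have hI := card_isotropic_differences_le hF hg hd hell A hA
  have hIsum : (#{p ∈ A ×ˢ A | (p.1 - p.2) ⬝ᵥ (p.1 - p.2) = 0} : ℝ) =
      ∑ c ∈ A, (#{a ∈ A | (a - c) ⬝ᵥ (a - c) = 0} : ℝ) := by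
    norm_cast
    rw [card_filter, sum_product_right]
    simp_rw [card_filter]
  have hstep : ∀ c ∈ A, (#{p ∈ A ×ˢ A | (p.1 - c) ⬝ᵥ (p.2 - c) = 0} : ℝ) ≤
      ((#A : ℝ) ^ 2 / q + 2 * L * #A) + 2 * #A * #{a ∈ A | (a - c) ⬝ᵥ (a - c) = 0} := by
    intro c hc
    have h1 := card_right_angles_anisotropic_le A hA (hA c hc)
    rw [← hq, hsqrt] at h1
    have hsub : ({p ∈ A ×ˢ A | (p.1 - c) ⬝ᵥ (p.2 - c) = 0} : Finset _) ⊆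
        {p ∈ A ×ˢ A | (p.1 - c) ⬝ᵥ (p.2 - c) = 0 ∧ (p.1 - c) ⬝ᵥ (p.1 - c) ≠ 0 ∧
          (p.2 - c) ⬝ᵥ (p.2 - c) ≠ 0} ∪
        (({a ∈ A | (a - c) ⬝ᵥ (a - c) = 0} ×ˢ A) ∪ (A ×ˢ {a ∈ A | (a - c) ⬝ᵥ (a - c) = 0})) := by
      intro p hp
      simp only [mem_union, mem_filter, mem_product] at hp ⊢
      tauto
    have h2 := (card_le_card hsub).trans ((card_union_le _ _).trans
      (add_le_add_right (card_union_le _ _) _))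
    rw [card_product, card_product] at h2
    have h3 : (#{p ∈ A ×ˢ A | (p.1 - c) ⬝ᵥ (p.2 - c) = 0} : ℝ) ≤
        #{p ∈ A ×ˢ A | (p.1 - c) ⬝ᵥ (p.2 - c) = 0 ∧ (p.1 - c) ⬝ᵥ (p.1 - c) ≠ 0 ∧
          (p.2 - c) ⬝ᵥ (p.2 - c) ≠ 0} + (#{a ∈ A | (a - c) ⬝ᵥ (a - c) = 0} * #A +
          #A * #{a ∈ A | (a - c) ⬝ᵥ (a - c) = 0}) := by
      exact_mod_cast h2
    linarith
  have hE : (addEnergy A A : ℝ) ≤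
      ∑ c ∈ A, (#{p ∈ A ×ˢ A | (p.1 - c) ⬝ᵥ (p.2 - c) = 0} : ℝ) := by
    exact_mod_cast addEnergy_le_sum_right_angles hF A hA
  calc (addEnergy A A : ℝ) ≤ ∑ c ∈ A, (((#A : ℝ) ^ 2 / q + 2 * L * #A) +
        2 * #A * #{a ∈ A | (a - c) ⬝ᵥ (a - c) = 0}) := hE.trans (sum_le_sum hstep)
    _ = #A * ((#A : ℝ) ^ 2 / q + 2 * L * #A) +
        2 * #A * #{p ∈ A ×ˢ A | (p.1 - p.2) ⬝ᵥ (p.1 - p.2) = 0} := by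
      rw [sum_add_distrib, sum_const, nsmul_eq_mul, ← mul_sum, hIsum]
    _ ≤ #A * ((#A : ℝ) ^ 2 / q + 2 * L * #A) + 2 * #A * ((#A : ℝ) ^ 2 / q + 2 * L * #A) := by
      gcongr
      refine hI.trans ?_
      gcongr
    _ ≤ 6 * ((#A : ℝ) ^ 3 / q + L * (#A : ℝ) ^ 2) := by
      -- The left side equals 3|A|³/q + 6L|A|², whence the constant 6.
      have : 0 ≤ (#A : ℝ) ^ 3 / q := by positivity
      linear_combination 3 * this

end Sphere

/-! ### Primitive elements are nonsquares; conclusion. -/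

theorem IsPrimitiveElement.not_isSquare {F : Type*} [Field F] [Fintype F] {g : F}
    (hg : IsPrimitiveElement g) (hodd : Odd (Fintype.card F)) : ¬ IsSquare g := by
  classical
  obtain ⟨u, rfl, hu⟩ := hg
  rintro ⟨h, hh⟩
  have hh0 : h ≠ 0 := by
    rintro rfl
    exact u.ne_zero (by simp at hh)
  have huw : u = Units.mk0 h hh0 ^ 2 := Units.ext (by simp [hh, sq])
  have hord : orderOf u = Fintype.card Fˣ := by
    rw [← Nat.card_zpowers, hu, Nat.card_congr Subgroup.topEquiv.toEquiv, Nat.card_eq_fintype_card]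
  obtain ⟨k, hk⟩ := hodd
  have hcard : Fintype.card Fˣ = 2 * k := by rw [Fintype.card_units, hk]; omega
  have hpos : 0 < Fintype.card Fˣ := Fintype.card_pos
  have h1 : u ^ k = 1 := by rw [huw, ← pow_mul, ← hcard, pow_card_eq_one]
  have := Nat.le_of_dvd (by omega) (orderOf_dvd_of_pow_eq_one h1)
  omega

theorem theorem2p3 :
    ∃ C : ℝ, 0 < C ∧
      ∀ (F : Type*) [Field F] [Fintype F] [DecidableEq F] (d : ℕ) (g : F)
        (A : Finset (Fin d → F)),
        Odd (Fintype.card F) →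
        IsPrimitiveElement g →
        ((∃ k : ℕ, d = 4 * k + 1) ∨
          ((∃ k : ℕ, 1 ≤ k ∧ d = 4 * k - 1) ∧ Fintype.card F % 4 = 1)) →
        (A : Set (Fin d → F)) ⊆ quadricSphere d g →
        (Finset.addEnergy A A : ℝ) ≤
          C * ((A.card : ℝ) ^ 3 / (Fintype.card F : ℝ) +
            (Fintype.card F : ℝ) ^ (((d : ℝ) - 2) / 2) * (A.card : ℝ) ^ 2) := by
  refine ⟨6, by norm_num, ?_⟩
  intro F _ _ _ d g A hodd hprim hd hA
  have hF : ringChar F ≠ 2 := fun h => by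
    have := FiniteField.even_card_iff_char_two.mp h
    rw [Nat.odd_iff] at hodd
    omega
  have hg0 : g ≠ 0 := by
    obtain ⟨u, rfl, -⟩ := hprim
    exact u.ne_zero
  have hg : quadraticChar F g = -1 :=
    quadraticChar_neg_one_iff_not_isSquare.mpr (hprim.not_isSquare hodd)
  have hneg : quadraticChar F (-1) ^ 2 = 1 := quadraticChar_sq_one (neg_ne_zero.mpr one_ne_zero)
  have hmul : quadraticChar F (-g) = quadraticChar F (-1) * -1 := by
    rw [← hg, ← map_mul, neg_one_mul]
  have hA' : ∀ a ∈ A, a ⬝ᵥ a = g := fun a ha => by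
    have h : ∑ i, a i ^ 2 = g := hA ha
    rw [← h, dotProduct]
    simp_rw [sq]
  obtain ⟨m, hm, hell⟩ : ∃ m, d = 2 * m + 1 ∧
      quadraticChar F (-1) ^ (m + 1) * quadraticChar F (-g) = -1 := by
    -- Since χ(-g) = -χ(-1), the sign is -χ(-1) ^ (m + 2). For d = 4k + 1 the exponent is even; for
    -- d = 4k - 1 it is odd, and q ≡ 1 mod 4 supplies χ(-1) = 1.
    rcases hd with ⟨k, rfl⟩ | ⟨⟨k, hk, rfl⟩, hq⟩
    · refine ⟨2 * k, by ring, ?_⟩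
      rw [hmul, ← mul_assoc, ← pow_succ, show 2 * k + 1 + 1 = 2 * (k + 1) by ring, pow_mul, hneg,
        one_pow, one_mul]
    · refine ⟨2 * k - 1, by omega, ?_⟩
      have h1 : quadraticChar F (-1) = 1 :=
        (quadraticChar_one_iff_isSquare (neg_ne_zero.mpr one_ne_zero)).mpr
          (FiniteField.isSquare_neg_one_iff.mpr (by omega))
      rw [hmul, h1, one_pow, one_mul, one_mul]
  exact addEnergy_le_of_elliptic hF hg0 hm hell A hA'
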